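/- Let $E$ be a (real) Banach lattice and let $T = (T(t))_{t \ge 0}$ be a positive $C_0$-semigroup on $E$ with generator $A \colon E \supseteq \operatorname{dom}(A) \to E$. Assume that $T$ is relatively uniformly continuous, i.e., for every $x \in E$ there exists a vector $u \in E_+$ such that for every $\varepsilon > 0$ there is a $t_0 > 0$ with $|T(t)x - x| \le \varepsilon u$ for all $t \in (0, t_0]$. Let $$ s(A) := \sup\{\operatorname{Re}\lambda : \lambda \in \sigma(A)\} \in [-\infty,\infty) $$ be the spectral bound of $A$, where $\sigma(A)$ denotes the spectrum of the complex extension of $A$ to the complexification of $E$ and $\sup\emptyset = -\infty$, and let $$ \omega_0(T) := \inf\{\omega \in \mathbb{R} : \exists M \ge 1 \text{ such that } \|T(t)\| \le M e^{\omega t} \text{ for all } t \ge 0\} \in [-\infty,\infty) $$ be the growth bound of $T$. Then $s(A) = \omega_0(T)$. -/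

import Mathlib

open Filter Topology
open scoped NNReal

namespace RucSemigroup

section Complexification

/-- The complexification `E ⊕ iE` of a real vector space `E`; the pair `(x, y)` stands for
`x + i y`. It carries the product topology. If `E` is a Banach lattice, this is the topology of the
lattice norm `‖ |x + i y| ‖`, since `max ‖x‖ ‖y‖ ≤ ‖ |x + i y| ‖ ≤ ‖x‖ + ‖y‖`. -/
def Complexification (E : Type*) : Type _ := E × E

namespace Complexification

variable {E : Type*}

instance [AddCommGroup E] : AddCommGroup (Complexification E) :=
  inferInstanceAs (AddCommGroup (E × E))

instance [TopologicalSpace E] : TopologicalSpace (Complexification E) :=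
  inferInstanceAs (TopologicalSpace (E × E))

variable [AddCommGroup E] [Module ℝ E]

/-- `(a + i b) • (x + i y) = (a x - b y) + i (a y + b x)`. -/
instance : SMul ℂ (Complexification E) :=
  ⟨fun c z => (c.re • z.1 - c.im • z.2, c.re • z.2 + c.im • z.1)⟩

instance : Module ℂ (Complexification E) where
  one_smul z := Prod.ext
    (show (1 : ℝ) • z.1 - (0 : ℝ) • z.2 = z.1 by simp)
    (show (1 : ℝ) • z.2 + (0 : ℝ) • z.1 = z.2 by simp)
  mul_smul c d z := Prod.ext
    (show (c.re * d.re - c.im * d.im) • z.1 - (c.re * d.im + c.im * d.re) • z.2 =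
      c.re • (d.re • z.1 - d.im • z.2) - c.im • (d.re • z.2 + d.im • z.1) by module)
    (show (c.re * d.re - c.im * d.im) • z.2 + (c.re * d.im + c.im * d.re) • z.1 =
      c.re • (d.re • z.2 + d.im • z.1) + c.im • (d.re • z.1 - d.im • z.2) by module)
  smul_zero c := Prod.ext
    (show c.re • (0 : E) - c.im • (0 : E) = 0 by simp)
    (show c.re • (0 : E) + c.im • (0 : E) = 0 by simp)
  smul_add c z w := Prod.ext
    (show c.re • (z.1 + w.1) - c.im • (z.2 + w.2) =
      (c.re • z.1 - c.im • z.2) + (c.re • w.1 - c.im • w.2) by module)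
    (show c.re • (z.2 + w.2) + c.im • (z.1 + w.1) =
      (c.re • z.2 + c.im • z.1) + (c.re • w.2 + c.im • w.1) by module)
  add_smul c d z := Prod.ext
    (show (c.re + d.re) • z.1 - (c.im + d.im) • z.2 =
      (c.re • z.1 - c.im • z.2) + (d.re • z.1 - d.im • z.2) by module)
    (show (c.re + d.re) • z.2 + (c.im + d.im) • z.1 =
      (c.re • z.2 + c.im • z.1) + (d.re • z.2 + d.im • z.1) by module)
  zero_smul z := Prod.ext
    (show (0 : ℝ) • z.1 - (0 : ℝ) • z.2 = 0 by simp)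
    (show (0 : ℝ) • z.2 + (0 : ℝ) • z.1 = 0 by simp)

end Complexification

/-- The complex extension `A (x + i y) = A x + i A y`, with domain `dom A ⊕ i dom A`, of a linear
operator `A : E ⊇ dom A → E`. -/
def complexExtension {E : Type*} [AddCommGroup E] [Module ℝ E] (A : E →ₗ.[ℝ] E) :
    Complexification E →ₗ.[ℂ] Complexification E where
  domain :=
    { carrier := {z | z.1 ∈ A.domain ∧ z.2 ∈ A.domain}
      add_mem' := fun hz hw => ⟨A.domain.add_mem hz.1 hw.1, A.domain.add_mem hz.2 hw.2⟩
      zero_mem' := ⟨A.domain.zero_mem, A.domain.zero_mem⟩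
      smul_mem' := fun c _ hz =>
        ⟨A.domain.sub_mem (A.domain.smul_mem c.re hz.1) (A.domain.smul_mem c.im hz.2),
          A.domain.add_mem (A.domain.smul_mem c.re hz.2) (A.domain.smul_mem c.im hz.1)⟩ }
  toFun :=
    { toFun := fun z => (A ⟨z.1.1, z.2.1⟩, A ⟨z.1.2, z.2.2⟩)
      map_add' := fun z w =>
        Prod.ext (A.map_add ⟨z.1.1, z.2.1⟩ ⟨w.1.1, w.2.1⟩)
          (A.map_add ⟨z.1.2, z.2.2⟩ ⟨w.1.2, w.2.2⟩)
      map_smul' := fun c z => by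
        refine Prod.ext ?_ ?_
        · change A (c.re • (⟨z.1.1, z.2.1⟩ : A.domain) - c.im • (⟨z.1.2, z.2.2⟩ : A.domain)) =
            c.re • A ⟨z.1.1, z.2.1⟩ - c.im • A ⟨z.1.2, z.2.2⟩
          rw [A.map_sub, A.map_smul, A.map_smul]
        · change A (c.re • (⟨z.1.2, z.2.2⟩ : A.domain) + c.im • (⟨z.1.1, z.2.1⟩ : A.domain)) =
            c.re • A ⟨z.1.2, z.2.2⟩ + c.im • A ⟨z.1.1, z.2.1⟩
          rw [A.map_add, A.map_smul, A.map_smul] }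

end Complexification

section Spectrum

/-- `μ` belongs to the resolvent set of the (possibly unbounded) operator `B` if
`μ - B : dom B → X` has an everywhere defined, continuous, linear two-sided inverse `R`. -/
def IsResolventPoint {X : Type*} [AddCommGroup X] [Module ℂ X] [TopologicalSpace X]
    (B : X →ₗ.[ℂ] X) (μ : ℂ) : Prop :=
  ∃ R : X →L[ℂ] X,
    (∀ x : B.domain, R (μ • (x : X) - B x) = x) ∧
    (∀ y : X, ∃ h : R y ∈ B.domain, μ • R y - B ⟨R y, h⟩ = y)

/-- The spectrum of a (possibly unbounded) operator on a complex topological vector space. -/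
def operatorSpectrum {X : Type*} [AddCommGroup X] [Module ℂ X] [TopologicalSpace X]
    (B : X →ₗ.[ℂ] X) : Set ℂ :=
  {μ | ¬ IsResolventPoint B μ}

/-- The spectral bound of an operator `A` on a real space, i.e. the supremum of the real parts of
the spectrum of the complex extension of `A`. It takes values in the extended reals, and the
supremum of the empty set is `-∞`. -/
noncomputable def spectralBound {E : Type*} [AddCommGroup E] [Module ℝ E] [TopologicalSpace E]
    (A : E →ₗ.[ℝ] E) : EReal :=
  sSup ((fun μ : ℂ => ((μ.re : ℝ) : EReal)) '' operatorSpectrum (complexExtension A))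

end Spectrum

/-- A `C₀`-semigroup (strongly continuous operator semigroup) on a real normed space. -/
structure C0Semigroup (E : Type*) [NormedAddCommGroup E] [NormedSpace ℝ E] where
  /-- The operator `T(t)` for `t ∈ [0, ∞)`. -/
  op : ℝ≥0 → E →L[ℝ] E
  op_zero : op 0 = ContinuousLinearMap.id ℝ E
  op_add : ∀ s t : ℝ≥0, op (s + t) = (op s).comp (op t)
  continuous_orbit : ∀ x : E, Continuous fun t : ℝ≥0 => op t x

namespace C0Semigroup

variable {E : Type*} [NormedAddCommGroup E] [NormedSpace ℝ E]

/-- `y` is the right derivative at `0` of the orbit of `x`. -/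
def HasOrbitDeriv (T : C0Semigroup E) (x y : E) : Prop :=
  Tendsto (fun t : ℝ≥0 => (t : ℝ)⁻¹ • (T.op t x - x)) (𝓝[>] 0) (𝓝 y)

theorem HasOrbitDeriv.add {T : C0Semigroup E} {x y x' y' : E} (h : T.HasOrbitDeriv x y)
    (h' : T.HasOrbitDeriv x' y') : T.HasOrbitDeriv (x + x') (y + y') := by
  refine (Tendsto.add h h').congr fun t => ?_
  rw [map_add]
  module

theorem HasOrbitDeriv.smul {T : C0Semigroup E} {x y : E} (c : ℝ) (h : T.HasOrbitDeriv x y) :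
    T.HasOrbitDeriv (c • x) (c • y) := by
  refine (Tendsto.const_smul h c).congr fun t => ?_
  rw [map_smul]
  module

theorem hasOrbitDeriv_zero (T : C0Semigroup E) : T.HasOrbitDeriv 0 0 := by
  simp [HasOrbitDeriv]

theorem HasOrbitDeriv.unique {T : C0Semigroup E} {x y y' : E} (h : T.HasOrbitDeriv x y)
    (h' : T.HasOrbitDeriv x y') : y = y' :=
  tendsto_nhds_unique h h'

/-- The generator `A x = lim_{t ↓ 0} (T(t) x - x) / t` of the semigroup, whose domain consists of
all `x` for which this limit exists. -/
noncomputable def generator (T : C0Semigroup E) : E →ₗ.[ℝ] E where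
  domain :=
    { carrier := {x | ∃ y, T.HasOrbitDeriv x y}
      add_mem' := fun ⟨_, h⟩ ⟨_, h'⟩ => ⟨_, h.add h'⟩
      zero_mem' := ⟨0, T.hasOrbitDeriv_zero⟩
      smul_mem' := fun c _ ⟨_, h⟩ => ⟨_, h.smul c⟩ }
  toFun :=
    { toFun := fun x => Classical.choose x.2
      map_add' := fun x y => (Classical.choose_spec (x + y).2).unique
        ((Classical.choose_spec x.2).add (Classical.choose_spec y.2))
      map_smul' := fun c x => (Classical.choose_spec (c • x).2).unique
        ((Classical.choose_spec x.2).smul c) }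

/-- The growth bound of the semigroup, as an extended real number. -/
noncomputable def growthBound (T : C0Semigroup E) : EReal :=
  sInf ((fun ω : ℝ => (ω : EReal)) ''
    {ω : ℝ | ∃ M : ℝ, 1 ≤ M ∧ ∀ t : ℝ≥0, ‖T.op t‖ ≤ M * Real.exp (ω * t)})

end C0Semigroup

/-- Relatively uniform convergence `f j → x` along a filter `l` in a vector lattice: there is a
regulator `u ≥ 0` such that, for every `ε > 0`, eventually `|f j - x| ≤ ε u`. -/
def RuTendsto {ι E : Type*} [AddCommGroup E] [Lattice E] [Module ℝ E]
    (f : ι → E) (l : Filter ι) (x : E) : Prop :=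
  ∃ u : E, 0 ≤ u ∧ ∀ ε : ℝ, 0 < ε → ∀ᶠ j in l, |f j - x| ≤ ε • u

namespace C0Semigroup

variable {E : Type*} [NormedAddCommGroup E] [NormedSpace ℝ E] [Lattice E]

/-- All operators of the semigroup are positive. -/
def IsPositive (T : C0Semigroup E) : Prop :=
  ∀ (t : ℝ≥0) (x : E), 0 ≤ x → 0 ≤ T.op t x

/-- The semigroup is relatively uniformly continuous (ruc): every orbit converges relatively
uniformly to its starting point as `t ↓ 0`. -/
def IsRuc (T : C0Semigroup E) : Prop :=
  ∀ x : E, RuTendsto (fun t : ℝ≥0 => T.op t x) (𝓝[>] 0) x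

end C0Semigroup

end RucSemigroup

/-!
For every `C₀`-semigroup `s(A) ≤ ω₀(T)`: if `‖T(t)‖ ≤ M exp(ω t)` and `Re μ > ω`, then the Laplace
transform `∫₀^∞ exp(-μ t) T(t) dt` on the complexification is the resolvent at `μ`
(`isResolventPoint_of_growth_lt_re`). The complexification is handled as the real Banach space
`X × X` on which `ℂ` acts by bounded operators, so that `exp(-μ t) T(t)` is again a real
`C₀`-semigroup, to which `exists_neg_inverse_generator` applies.

For the converse let `r > s(A)` be real, and let `S(t) = exp(-r t) T(t)`. Then `[r, ∞)` consists of
resolvent points. The resolvent is positive far to the right, where it is a limit of the integrals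
`∫₀^t S(s) ds`, and positivity spreads to the left along `[r, ∞)` by the resolvent identity, so
`R = (r - A)⁻¹` is positive (`exists_nonneg_isRealResolvent`). Hence
`∫₀^t S(s) v ds = R (v - S(t) v) ≤ R v` for all `v ≥ 0` and all `t`. Relative uniform continuity
gives, for each `x ≥ 0`, a `τ > 0` and a `v ≥ 0` with `S(s) x ≤ v` for all `s ∈ [0, τ]`. Averaging
`S(t) x = S(t - s) S(s) x ≤ S(t - s) v` over `s ∈ [0, τ]` yields
`τ S(t) x ≤ ∫_{t - τ}^t S(s) v ds ≤ R v` for `t ≥ τ`, so the orbits of `S` are bounded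
(`IsRealResolvent.exists_bound_rescale`). By the uniform boundedness principle `S` is bounded, that
is, `ω₀(T) ≤ r`.
-/

namespace RucSemigroup

namespace C0Semigroup

open MeasureTheory

/-! ### Orbits, bounded perturbations and the inverse of the generator -/

section General

variable {X : Type*} [NormedAddCommGroup X] [NormedSpace ℝ X]

/-- The orbit `s ↦ T(s) x`, extended to negative times by the constant `x`, so that it can be
integrated over real intervals. -/
def orbit (T : C0Semigroup X) (x : X) (s : ℝ) : X := T.op s.toNNReal x

theorem continuous_orbit_real (T : C0Semigroup X) (x : X) : Continuous (T.orbit x) :=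
  (T.continuous_orbit x).comp continuous_real_toNNReal

theorem op_op (T : C0Semigroup X) (s t : ℝ≥0) (x : X) : T.op s (T.op t x) = T.op (s + t) x := by
  rw [T.op_add]; rfl

theorem op_orbit (T : C0Semigroup X) (h : ℝ≥0) (x : X) {s : ℝ} (hs : 0 ≤ s) :
    T.op h (T.orbit x s) = T.orbit x (s + h) := by
  rw [orbit, orbit, op_op, Real.toNNReal_add hs h.coe_nonneg, Real.toNNReal_coe, add_comm]

theorem tendsto_coe_nhdsGT_zero : Tendsto ((↑) : ℝ≥0 → ℝ) (𝓝[>] 0) (𝓝[>] 0) := by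
  refine tendsto_nhdsWithin_iff.2 ⟨?_, ?_⟩
  · exact (NNReal.continuous_coe.tendsto' 0 0 rfl).mono_left nhdsWithin_le_nhds
  · filter_upwards [self_mem_nhdsWithin] with h hh
    exact NNReal.coe_pos.2 hh

theorem tendsto_average [CompleteSpace X] {f : ℝ → X} (hf : Continuous f) (t : ℝ) :
    Tendsto (fun h : ℝ≥0 => (h : ℝ)⁻¹ • ∫ s in t..t + h, f s) (𝓝[>] 0) (𝓝 (f t)) := by
  have h1 : HasDerivAt (fun u => ∫ s in t..u, f s) (f t) t :=
    intervalIntegral.integral_hasDerivAt_right (hf.intervalIntegrable _ _)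
      (hf.stronglyMeasurableAtFilter _ _) hf.continuousAt
  have h2 := (hasDerivAt_iff_tendsto_slope_zero.1 h1).mono_left
    (nhdsWithin_mono _ fun y (hy : 0 < y) => hy.ne')
  simpa [Function.comp_def] using h2.comp tendsto_coe_nhdsGT_zero

theorem op_integral_orbit [CompleteSpace X] (T : C0Semigroup X) (h t : ℝ≥0) (x : X) :
    T.op h (∫ s in (0 : ℝ)..t, T.orbit x s) = ∫ s in (h : ℝ)..t + h, T.orbit x s := by
  rw [← ContinuousLinearMap.intervalIntegral_comp_comm _
    ((T.continuous_orbit_real x).intervalIntegrable _ _)]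
  rw [intervalIntegral.integral_congr (g := fun s => T.orbit x (s + h))]
  · rw [intervalIntegral.integral_comp_add_right, zero_add]
  · intro s hs
    rw [Set.uIcc_of_le t.coe_nonneg] at hs
    exact T.op_orbit h x hs.1

/-- The integral of an orbit over `[0, t]` lies in the domain of the generator, which maps it to
`T(t) x - x`. -/
theorem hasOrbitDeriv_integral [CompleteSpace X] (T : C0Semigroup X) (t : ℝ≥0) (x : X) :
    T.HasOrbitDeriv (∫ s in (0 : ℝ)..t, T.orbit x s) (T.op t x - x) := by
  have hc := T.continuous_orbit_real x
  have h1 := (tendsto_average hc t).sub (tendsto_average hc 0)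
  have ht : T.orbit x t = T.op t x := by simp [orbit]
  have h0 : T.orbit x 0 = x := by simp [orbit, T.op_zero]
  rw [ht, h0] at h1
  refine h1.congr fun h => ?_
  rw [op_integral_orbit, ← smul_sub]
  congr 1
  have hi := fun a b : ℝ => hc.intervalIntegrable (μ := volume) a b
  have e1 := intervalIntegral.integral_add_adjacent_intervals (hi 0 h) (hi h (t + h))
  have e2 := intervalIntegral.integral_add_adjacent_intervals (hi 0 t) (hi t (t + h))
  rw [zero_add, sub_eq_sub_iff_add_eq_add]
  exact (add_comm _ _).trans ((e2.trans e1.symm).trans (add_comm _ _))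

/-- Every `C₀`-semigroup is exponentially bounded. -/
theorem exists_exponential_bound [CompleteSpace X] (T : C0Semigroup X) :
    ∃ ω M : ℝ, 1 ≤ M ∧ ∀ t : ℝ≥0, ‖T.op t‖ ≤ M * Real.exp (ω * t) := by
  obtain ⟨C, hC⟩ := banach_steinhaus (ι := Set.Icc (0 : ℝ≥0) 1) (g := fun t => T.op t) fun x => by
    obtain ⟨C, hC⟩ := isCompact_Icc.exists_bound_of_continuousOn
      (s := Set.Icc (0 : ℝ≥0) 1) (T.continuous_orbit x).continuousOn
    exact ⟨C, fun t => hC t t.2⟩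
  set M := max C 1 with hM
  have hM1 : 1 ≤ M := le_max_right _ _
  have hM0 : 0 < M := by linarith
  have hb : ∀ t : ℝ≥0, t ≤ 1 → ‖T.op t‖ ≤ M := fun t ht =>
    (hC ⟨t, zero_le, ht⟩).trans (le_max_left _ _)
  have hn : ∀ n : ℕ, ‖T.op n‖ ≤ M ^ n := by
    intro n
    induction n with
    | zero =>
      rw [Nat.cast_zero, T.op_zero, pow_zero]
      exact ContinuousLinearMap.norm_id_le
    | succ n ih =>
      rw [Nat.cast_succ, T.op_add, pow_succ]
      exact (ContinuousLinearMap.opNorm_comp_le _ _).trans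
        (mul_le_mul ih (hb 1 le_rfl) (norm_nonneg _) (by positivity))
  refine ⟨Real.log M, M, hM1, fun t => ?_⟩
  have hfl : (⌊t⌋₊ : ℝ≥0) ≤ t := Nat.floor_le zero_le
  have hr : t - ⌊t⌋₊ ≤ 1 := by
    rw [tsub_le_iff_left]
    exact (Nat.lt_floor_add_one t).le
  calc ‖T.op t‖ = ‖(T.op (t - ⌊t⌋₊)).comp (T.op ⌊t⌋₊)‖ := by
        rw [← T.op_add, tsub_add_cancel_of_le hfl]
    _ ≤ M * M ^ ⌊t⌋₊ := (ContinuousLinearMap.opNorm_comp_le _ _).trans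
        (mul_le_mul (hb _ hr) (hn _) (norm_nonneg _) hM0.le)
    _ ≤ M * Real.exp (Real.log M * t) := by
        gcongr
        rw [← Real.rpow_def_of_pos hM0, ← Real.rpow_natCast]
        exact Real.rpow_le_rpow_of_exponent_le hM1 (by exact_mod_cast hfl)

/-- The semigroup `t ↦ exp(t G) T(t)` for a bounded operator `G` that commutes with `T`; its
generator is `A + G` (`hasOrbitDeriv_expTwist_iff`). -/
noncomputable def expTwist [CompleteSpace X] (T : C0Semigroup X) (G : X →L[ℝ] X)
    (hG : ∀ t, Commute G (T.op t)) : C0Semigroup X where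
  op t := NormedSpace.exp ((t : ℝ) • G) * T.op t
  op_zero := by
    rw [NNReal.coe_zero, zero_smul, NormedSpace.exp_zero, T.op_zero]
    exact one_mul (1 : X →L[ℝ] X)
  op_add s t := by
    let _ := NormedAlgebra.restrictScalars ℚ ℝ (X →L[ℝ] X)
    have h1 : NormedSpace.exp (((s + t : ℝ≥0) : ℝ) • G) =
        NormedSpace.exp ((s : ℝ) • G) * NormedSpace.exp ((t : ℝ) • G) := by
      rw [NNReal.coe_add, add_smul]
      exact NormedSpace.exp_add_of_commute (((Commute.refl G).smul_left _).smul_right _)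
    have h2 : Commute (NormedSpace.exp ((t : ℝ) • G)) (T.op s) :=
      ((hG s).smul_left (t : ℝ)).exp_left
    have h3 : T.op (s + t) = T.op s * T.op t := T.op_add s t
    rw [h1, h3]
    change _ = (NormedSpace.exp ((s : ℝ) • G) * T.op s) * (NormedSpace.exp ((t : ℝ) • G) * T.op t)
    rw [mul_assoc, mul_assoc, ← mul_assoc _ (T.op s), h2.eq, mul_assoc]
  continuous_orbit x := by
    let _ := NormedAlgebra.restrictScalars ℚ ℝ (X →L[ℝ] X)
    have h : Continuous fun t : ℝ≥0 => NormedSpace.exp ((t : ℝ) • G) :=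
      NormedSpace.exp_continuous.comp (NNReal.continuous_coe.smul continuous_const)
    exact h.clm_apply (T.continuous_orbit x)

theorem expTwist_op [CompleteSpace X] (T : C0Semigroup X) (G : X →L[ℝ] X)
    (hG : ∀ t, Commute G (T.op t)) (t : ℝ≥0) :
    (T.expTwist G hG).op t = NormedSpace.exp ((t : ℝ) • G) * T.op t := rfl

theorem hasOrbitDeriv_expTwist_iff [CompleteSpace X] (T : C0Semigroup X) (G : X →L[ℝ] X)
    (hG : ∀ t, Commute G (T.op t)) (x y : X) :
    (T.expTwist G hG).HasOrbitDeriv x (y + G x) ↔ T.HasOrbitDeriv x y := by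
  have h1 : Tendsto (fun h : ℝ≥0 => (h : ℝ)⁻¹ • (NormedSpace.exp ((h : ℝ) • G) - 1)) (𝓝[>] 0)
      (𝓝 G) := by
    have h2 : HasDerivAt (fun u : ℝ => NormedSpace.exp (u • G)) G 0 := by
      simpa using hasDerivAt_exp_smul_const (𝕂 := ℝ) G 0
    have h3 := (hasDerivAt_iff_tendsto_slope_zero.1 h2).mono_left
      (nhdsWithin_mono _ fun y (hy : 0 < y) => hy.ne')
    simpa [Function.comp_def] using h3.comp tendsto_coe_nhdsGT_zero
  have h2 : Tendsto (fun h : ℝ≥0 => T.op h x) (𝓝[>] 0) (𝓝 x) :=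
    ((T.continuous_orbit x).tendsto' 0 x (by simp [T.op_zero])).mono_left nhdsWithin_le_nhds
  -- The difference quotients of `exp(t G) T(t) x` and of `T(t) x` differ by the following term,
  -- which converges for every `x`; so the two orbits are differentiable for the same `x`.
  have h3 : Tendsto (fun h : ℝ≥0 =>
      ((h : ℝ)⁻¹ • (NormedSpace.exp ((h : ℝ) • G) - 1)) (T.op h x)) (𝓝[>] 0) (𝓝 (G x)) :=
    (isBoundedBilinearMap_apply.continuous.tendsto (G, x)).comp (h1.prodMk_nhds h2)
  constructor
  · intro h
    have := Tendsto.sub h h3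
    rw [add_sub_cancel_right] at this
    refine this.congr fun t => ?_
    rw [← sub_eq_zero]
    simp [expTwist_op]
    module
  · intro h
    refine (Tendsto.add h h3).congr fun t => ?_
    rw [← sub_eq_zero]
    simp [expTwist_op]
    module

/-- A uniformly exponentially stable semigroup has an invertible generator: the operator
`V x = ∫₀^∞ T(s) x ds` satisfies `A V x = -x` for all `x`, and `V A x = -x` for `x ∈ dom A`. -/
theorem exists_neg_inverse_generator [CompleteSpace X] (T : C0Semigroup X) {M ε : ℝ} (hε : 0 < ε)
    (hT : ∀ t : ℝ≥0, ‖T.op t‖ ≤ M * Real.exp (-ε * t)) :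
    ∃ V : X →L[ℝ] X, (∀ x, T.HasOrbitDeriv (V x) (-x)) ∧
      ∀ x y, T.HasOrbitDeriv x y → V y = -x := by
  have hb : ∀ x, ∀ s ∈ Set.Ioi (0 : ℝ), ‖T.orbit x s‖ ≤ (M * ‖x‖) * Real.exp (-ε * s) := by
    intro x s hs
    have := (T.op s.toNNReal).le_of_opNorm_le (hT _) x
    rw [Real.coe_toNNReal s (le_of_lt hs)] at this
    refine this.trans_eq (by ring)
  have hexp : IntegrableOn (fun s : ℝ => Real.exp (-ε * s)) (Set.Ioi 0) :=
    exp_neg_integrableOn_Ioi 0 hε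
  have hint : ∀ x, IntegrableOn (T.orbit x) (Set.Ioi 0) := fun x =>
    Integrable.mono' (hexp.const_mul (M * ‖x‖)) (T.continuous_orbit_real x).aestronglyMeasurable
      ((ae_restrict_iff' measurableSet_Ioi).2 (ae_of_all _ (hb x)))
  let V₀ : X →ₗ[ℝ] X :=
    { toFun := fun x => ∫ s in Set.Ioi (0 : ℝ), T.orbit x s
      map_add' := fun x y => by
        rw [← integral_add (hint x) (hint y)]
        simp [orbit]
      map_smul' := fun c x => by
        rw [RingHom.id_apply, ← integral_smul]
        simp [orbit] }
  let V : X →L[ℝ] X := V₀.mkContinuous (M * ∫ s in Set.Ioi (0 : ℝ), Real.exp (-ε * s)) fun x => by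
    have := norm_integral_le_of_norm_le (hexp.const_mul (M * ‖x‖))
      ((ae_restrict_iff' measurableSet_Ioi).2 (ae_of_all _ (hb x)))
    rw [integral_const_mul] at this
    exact this.trans_eq (by ring)
  have hV : ∀ x, V x = ∫ s in Set.Ioi (0 : ℝ), T.orbit x s := fun x => rfl
  have hcomm : ∀ (h : ℝ≥0) x, T.op h (V x) = V (T.op h x) := by
    intro h x
    rw [hV, hV, ← ContinuousLinearMap.integral_comp_comm _ (hint x)]
    congr 1
    funext s
    rw [orbit, orbit, op_op, op_op, add_comm]
  -- `T(h) V x = ∫_h^∞ T(s) x ds`, so the difference quotient of the orbit of `V x` is minus an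
  -- average of the orbit of `x` over `[0, h]`.
  have hshift : ∀ (h : ℝ≥0) x, T.op h (V x) = V x - ∫ s in (0 : ℝ)..0 + h, T.orbit x s := by
    intro h x
    have hi : IntegrableOn (T.orbit x) (Set.Ioi (h : ℝ)) :=
      (hint x).mono_set (Set.Ioi_subset_Ioi h.2)
    have hpre := (measurePreserving_add_right volume (h : ℝ)).setIntegral_preimage_emb
      (measurableEmbedding_addRight (h : ℝ)) (T.orbit x) (Set.Ioi (h : ℝ))
    rw [Set.preimage_add_const_Ioi, sub_self] at hpre
    rw [hV, ← ContinuousLinearMap.integral_comp_comm _ (hint x), zero_add, eq_sub_iff_add_eq',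
      setIntegral_congr_fun (g := fun s => T.orbit x (s + h)) measurableSet_Ioi
        (fun s hs => T.op_orbit h x (le_of_lt hs)), hpre]
    exact intervalIntegral.integral_interval_add_Ioi (hint x) hi
  have havg : ∀ x, Tendsto (fun h : ℝ≥0 => (h : ℝ)⁻¹ • (T.op h (V x) - V x)) (𝓝[>] 0)
      (𝓝 (-x)) := by
    intro x
    have h1 := (tendsto_average (T.continuous_orbit_real x) 0).neg
    have h0 : T.orbit x 0 = x := by simp [orbit, T.op_zero]
    rw [h0] at h1
    refine h1.congr fun h => ?_
    rw [hshift]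
    module
  refine ⟨V, havg, fun x y hxy => ?_⟩
  refine tendsto_nhds_unique ((V.continuous.tendsto y).comp hxy) ((havg x).congr fun h => ?_)
  simp [hcomm]

end General

/-! ### The Laplace transform of a semigroup -/

section Resolvent

variable {X : Type*} [NormedAddCommGroup X] [NormedSpace ℝ X]

theorem HasOrbitDeriv.map {T : C0Semigroup X} {x y : X} (h : T.HasOrbitDeriv x y) {K : X →L[ℝ] X}
    (hK : ∀ t, Commute K (T.op t)) : T.HasOrbitDeriv (K x) (K y) := by
  refine ((K.continuous.tendsto y).comp h).congr fun t => ?_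
  have h1 : K (T.op t x) = T.op t (K x) := DFunLike.congr_fun (hK t).eq x
  simp [h1]

theorem hasOrbitDeriv_generator (T : C0Semigroup X) (x : T.generator.domain) :
    T.HasOrbitDeriv x (T.generator x) :=
  Classical.choose_spec x.2

theorem HasOrbitDeriv.generator_eq {T : C0Semigroup X} {x y : X} (h : T.HasOrbitDeriv x y) :
    T.generator ⟨x, y, h⟩ = y :=
  (T.hasOrbitDeriv_generator ⟨x, y, h⟩).unique h

/-- The semigroup `(x, y) ↦ (T(t) x, T(t) y)` on `X × X`. -/
def diag (T : C0Semigroup X) : C0Semigroup (X × X) where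
  op t := (T.op t).prodMap (T.op t)
  op_zero := by rw [T.op_zero]; rfl
  op_add s t := by rw [T.op_add]; rfl
  continuous_orbit x := (T.continuous_orbit x.1).prodMk (T.continuous_orbit x.2)

theorem hasOrbitDeriv_diag_iff (T : C0Semigroup X) (z w : X × X) :
    T.diag.HasOrbitDeriv z w ↔ T.HasOrbitDeriv z.1 w.1 ∧ T.HasOrbitDeriv z.2 w.2 :=
  Prod.tendsto_iff _ _

variable (X) in
/-- The action of `ℂ` on the real Banach space `X × X`, where `(x, y)` stands for `x + i y`, as a
homomorphism into the bounded real-linear operators. -/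
noncomputable def complexAction : ℂ →ₐ[ℝ] (X × X →L[ℝ] X × X) :=
  Complex.lift ⟨(-ContinuousLinearMap.snd ℝ X X).prod (ContinuousLinearMap.fst ℝ X X), by
    ext z <;> simp⟩

theorem complexAction_apply (c : ℂ) (z : X × X) :
    complexAction X c z = (c.re • z.1 - c.im • z.2, c.re • z.2 + c.im • z.1) := by
  ext <;>
    simp [complexAction, Complex.liftAux_apply, Algebra.algebraMap_eq_smul_one, sub_eq_add_neg]

theorem commute_complexAction_diag (T : C0Semigroup X) (c : ℂ) (t : ℝ≥0) :
    Commute (complexAction X c) (T.diag.op t) := by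
  refine ContinuousLinearMap.ext fun z => ?_
  change complexAction X c (T.op t z.1, T.op t z.2) =
    (T.op t (complexAction X c z).1, T.op t (complexAction X c z).2)
  simp [complexAction_apply]

/-- The resolvent of the generator as a Laplace transform: the right half-plane beyond any
exponential growth rate of the semigroup consists of resolvent points. -/
theorem isResolventPoint_of_growth_lt_re [CompleteSpace X] (T : C0Semigroup X) {ω M : ℝ}
    (hT : ∀ t : ℝ≥0, ‖T.op t‖ ≤ M * Real.exp (ω * t)) {μ : ℂ} (hμ : ω < μ.re) :
    IsResolventPoint (complexExtension T.generator) μ := by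
  set φ := complexAction X with hφ
  have hφc : Continuous φ := φ.toLinearMap.continuous_of_finiteDimensional
  set C := ‖(LinearMap.toContinuousLinearMap φ.toLinearMap : ℂ →L[ℝ] (X × X →L[ℝ] X × X))‖
  have hC : ∀ c, ‖φ c‖ ≤ C * ‖c‖ := fun c =>
    (LinearMap.toContinuousLinearMap φ.toLinearMap).le_opNorm c
  have hG := T.commute_complexAction_diag (-μ)
  set S := T.diag.expTwist (φ (-μ)) hG with hS
  have hexp : ∀ t : ℝ, NormedSpace.exp (t • φ (-μ)) = φ (Complex.exp (t • (-μ))) := by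
    intro t
    let _ := NormedAlgebra.restrictScalars ℚ ℝ (X × X →L[ℝ] X × X)
    rw [← map_smul, ← NormedSpace.map_exp φ hφc, Complex.exp_eq_exp_ℂ]
  have hSnorm : ∀ t : ℝ≥0, ‖S.op t‖ ≤ (C * M) * Real.exp (-(μ.re - ω) * t) := by
    intro t
    have h1 : ‖T.diag.op t‖ ≤ M * Real.exp (ω * t) := by
      refine ContinuousLinearMap.opNorm_le_bound _ ((norm_nonneg _).trans (hT t)) fun z => ?_
      refine (Prod.norm_def _).trans_le (max_le ?_ ?_)
      · exact ((T.op t).le_of_opNorm_le_of_le (hT t) (norm_fst_le z))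
      · exact ((T.op t).le_of_opNorm_le_of_le (hT t) (norm_snd_le z))
    rw [hS, expTwist_op, hexp]
    refine (norm_mul_le _ _).trans ((mul_le_mul (hC _) h1 (norm_nonneg _)
      (by positivity)).trans_eq ?_)
    rw [Complex.norm_exp, mul_mul_mul_comm, ← Real.exp_add]
    congr 2
    simp
    ring
  obtain ⟨V, hV1, hV2⟩ := S.exists_neg_inverse_generator (sub_pos.2 hμ) hSnorm
  have hφS : ∀ c t, Commute (φ c) (S.op t) := by
    intro c t
    rw [hS, expTwist_op, hexp]
    refine Commute.mul_right ?_ (T.commute_complexAction_diag c t)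
    exact (Commute.all c _).map φ
  -- The generator of `S` is the generator of `T.diag` minus multiplication by `μ`.
  have hiff : ∀ z w, S.HasOrbitDeriv z (w - φ μ z) ↔ T.diag.HasOrbitDeriv z w := by
    intro z w
    rw [← hasOrbitDeriv_expTwist_iff T.diag (φ (-μ)) hG]
    simp only [map_neg, neg_apply, sub_eq_add_neg, hS]
  have hsmul : ∀ (c : ℂ) (z : Complexification X), (c • z : Complexification X) = φ c z :=
    fun c z => (complexAction_apply c z).symm
  -- `V` is complex linear: `φ c` commutes with `S`, hence with the inverse of its generator.
  have hVφ : ∀ (c : ℂ) (z : X × X), V (φ c z) = φ c (V z) := by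
    intro c z
    have h1 := hV2 _ _ ((hV1 z).map (hφS c))
    rw [map_neg, map_neg] at h1
    exact neg_injective h1
  let R : Complexification X →L[ℂ] Complexification X :=
    { toFun := fun z => V z
      map_add' := fun z w => V.map_add z w
      map_smul' := fun c z => by
        exact (congrArg V (hsmul c z)).trans ((hVφ c z).trans (hsmul c (V z)).symm)
      cont := V.continuous }
  refine ⟨R, fun z => ?_, fun (z : X × X) => ?_⟩
  · set x : X × X := z.1 with hx
    set y : X × X := complexExtension T.generator z with hy
    have h1 : T.diag.HasOrbitDeriv x y :=
      (T.hasOrbitDeriv_diag_iff _ _).2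
        ⟨T.hasOrbitDeriv_generator ⟨_, z.2.1⟩, T.hasOrbitDeriv_generator ⟨_, z.2.2⟩⟩
    have h2 : V (φ μ x - y) = x := by
      rw [← neg_sub, map_neg, hV2 _ _ ((hiff _ _).2 h1), neg_neg]
    exact (congrArg (fun w : X × X => V (w - y)) (hsmul μ x)).trans h2
  · have h1 : T.diag.HasOrbitDeriv (V z) (φ μ (V z) - z) := by
      rw [← hiff, sub_sub_cancel_left]
      exact hV1 z
    obtain ⟨h2, h3⟩ := (T.hasOrbitDeriv_diag_iff _ _).1 h1
    refine ⟨⟨⟨_, h2⟩, ⟨_, h3⟩⟩, ?_⟩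
    have h4 : complexExtension T.generator ⟨R z, ⟨_, h2⟩, ⟨_, h3⟩⟩ = φ μ (V z) - z :=
      Prod.ext h2.generator_eq h3.generator_eq
    rw [h4]
    exact (congrArg (fun w : X × X => w - (φ μ (V z) - z)) (hsmul μ (V z))).trans
      (sub_sub_cancel _ _)

theorem spectralBound_le_growthBound [CompleteSpace X] (T : C0Semigroup X) :
    spectralBound T.generator ≤ T.growthBound := by
  refine le_sInf ?_
  rintro _ ⟨ω, ⟨M, -, hM⟩, rfl⟩
  refine sSup_le ?_
  rintro _ ⟨μ, hμ, rfl⟩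
  by_contra! h
  exact hμ (T.isResolventPoint_of_growth_lt_re hM (EReal.coe_lt_coe_iff.1 h))

end Resolvent

/-! ### Real resolvents and rescaling -/

section RealResolvent

variable {X : Type*} [NormedAddCommGroup X] [NormedSpace ℝ X]

/-- The bounded operator `R` is the resolvent `(r - A)⁻¹` of the generator `A` of `T` at the real
number `r`. -/
structure IsRealResolvent (T : C0Semigroup X) (r : ℝ) (R : X →L[ℝ] X) : Prop where
  leftInv : ∀ {x y : X}, T.HasOrbitDeriv x y → R (r • x - y) = x
  hasOrbitDeriv : ∀ x : X, T.HasOrbitDeriv (R x) (r • R x - x)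

/-- The first component of the restriction to `X × 0` of the resolvent of the complex extension is
the resolvent of the generator. -/
theorem exists_isRealResolvent (T : C0Semigroup X) {r : ℝ}
    (hr : IsResolventPoint (complexExtension T.generator) r) : ∃ R, T.IsRealResolvent r R := by
  obtain ⟨R, hR1, hR2⟩ := hr
  have hsmul : ∀ (c : ℝ) (z : Complexification X), (c : ℂ) • z = (c • z.1, c • z.2) := by
    intro c z
    refine Prod.ext ?_ ?_
    · change (c : ℂ).re • z.1 - (c : ℂ).im • z.2 = c • z.1
      simp
    · change (c : ℂ).re • z.2 + (c : ℂ).im • z.1 = c • z.2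
      simp
  let ι : X → Complexification X := fun x => ((x, 0) : X × X)
  have hι : ∀ (c : ℝ) x, ι (c • x) = (c : ℂ) • ι x := by
    intro c x
    rw [hsmul]
    exact Prod.ext rfl (smul_zero c).symm
  have hιadd : ∀ x y, ι (x + y) = ι x + ι y := fun x y => Prod.ext rfl (add_zero 0).symm
  let R' : X →L[ℝ] X :=
    { toFun := fun x => (R (ι x)).1
      map_add' := fun x y => by rw [hιadd, map_add]; rfl
      map_smul' := fun c x => by rw [hι, map_smul, hsmul]; rfl
      cont := continuous_fst.comp (R.continuous.comp (Continuous.prodMk_left (0 : X))) }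
  refine ⟨R', ?_, ?_⟩
  · intro x y hxy
    have h0 := T.hasOrbitDeriv_zero
    have h1 := hR1 ⟨ι x, ⟨y, hxy⟩, ⟨0, h0⟩⟩
    have h2 : ι (r • x - y) = (r : ℂ) • ι x -
        complexExtension T.generator ⟨ι x, ⟨y, hxy⟩, ⟨0, h0⟩⟩ := by
      rw [hsmul]
      refine Prod.ext ?_ ?_
      · exact congrArg (r • x - ·) hxy.generator_eq.symm
      · change (0 : X) = r • 0 - T.generator ⟨0, ⟨0, h0⟩⟩
        rw [h0.generator_eq, smul_zero, sub_zero]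
    change (R (ι (r • x - y))).1 = x
    rw [h2, h1]
  · intro x
    obtain ⟨h, h1⟩ := hR2 (ι x)
    have h2 := T.hasOrbitDeriv_generator ⟨_, h.1⟩
    rw [hsmul] at h1
    have h3 : r • R' x - T.generator ⟨R' x, h.1⟩ = x := congrArg Prod.fst h1
    have h4 : T.generator ⟨R' x, h.1⟩ = r • R' x - x := by
      rw [eq_sub_iff_add_eq, ← eq_sub_iff_add_eq', h3]
    exact h4 ▸ h2

/-- The resolvent identity. -/
theorem IsRealResolvent.apply_eq {T : C0Semigroup X} {a b : ℝ} {P Q : X →L[ℝ] X}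
    (hP : T.IsRealResolvent a P) (hQ : T.IsRealResolvent b Q) (x : X) :
    Q x = P x + (a - b) • P (Q x) := by
  calc Q x = P (a • Q x - (b • Q x - x)) := (hP.leftInv (hQ.hasOrbitDeriv x)).symm
    _ = P x + (a - b) • P (Q x) := by
      simp only [map_sub, map_smul]
      module

/-- The rescaled semigroup `t ↦ exp(-r t) T(t)`. -/
noncomputable def rescale [CompleteSpace X] (T : C0Semigroup X) (r : ℝ) : C0Semigroup X :=
  T.expTwist (algebraMap ℝ (X →L[ℝ] X) (-r)) fun _ =>
    Algebra.commute_algebraMap_left _ _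

theorem rescale_op [CompleteSpace X] (T : C0Semigroup X) (r : ℝ) (t : ℝ≥0) :
    (T.rescale r).op t = Real.exp (-(r * t)) • T.op t := by
  have h : (t : ℝ) • algebraMap ℝ (X →L[ℝ] X) (-r) = algebraMap ℝ (X →L[ℝ] X) (-(r * t)) := by
    rw [Algebra.smul_def, ← map_mul, mul_neg, mul_comm]
  rw [rescale, expTwist_op, h, ← NormedSpace.algebraMap_exp_comm, ← Algebra.smul_def,
    Real.exp_eq_exp_ℝ]

/-- Partial Laplace integrals in terms of the resolvent:
`∫₀^t exp(-r s) T(s) x ds = (r - A)⁻¹ (x - exp(-r t) T(t) x)`. -/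
theorem IsRealResolvent.integral_orbit [CompleteSpace X] {T : C0Semigroup X} {r : ℝ}
    {R : X →L[ℝ] X} (hR : T.IsRealResolvent r R) (t : ℝ≥0) (x : X) :
    ∫ s in (0 : ℝ)..t, (T.rescale r).orbit x s = R (x - (T.rescale r).op t x) := by
  set v := ∫ s in (0 : ℝ)..t, (T.rescale r).orbit x s
  have h1 : (T.rescale r).HasOrbitDeriv v ((T.rescale r).op t x - x + r • v +
      algebraMap ℝ (X →L[ℝ] X) (-r) v) := by
    have h2 : (T.rescale r).op t x - x + r • v + algebraMap ℝ (X →L[ℝ] X) (-r) v =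
        (T.rescale r).op t x - x := by
      simp [Algebra.algebraMap_eq_smul_one]
    rw [h2]
    exact (T.rescale r).hasOrbitDeriv_integral t x
  have h3 := hR.leftInv ((hasOrbitDeriv_expTwist_iff _ _ _ _ _).1 h1)
  rw [← h3]
  congr 1
  abel

end RealResolvent

/-! ### Positive semigroups on Banach lattices -/

section Positive

theorem norm_le_norm_of_nonneg_of_le {E : Type*} [NormedAddCommGroup E] [Lattice E]
    [IsOrderedAddMonoid E] [HasSolidNorm E] {x y : E} (hx : 0 ≤ x) (hxy : x ≤ y) : ‖x‖ ≤ ‖y‖ :=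
  norm_le_norm_of_abs_le_abs (by rwa [abs_of_nonneg hx, abs_of_nonneg (hx.trans hxy)])

theorem IsPositive.rescale {E : Type*} [NormedAddCommGroup E] [NormedSpace ℝ E] [Lattice E]
    [IsOrderedModule ℝ E] [CompleteSpace E] {T : C0Semigroup E} (hpos : T.IsPositive) (r : ℝ) :
    (T.rescale r).IsPositive := by
  intro t x hx
  rw [rescale_op]
  exact smul_nonneg (Real.exp_pos _).le (hpos t x hx)

variable {E : Type*} [NormedAddCommGroup E] [NormedSpace ℝ E] [Lattice E]
  [IsOrderedAddMonoid E] [IsOrderedModule ℝ E] [HasSolidNorm E]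

theorem intervalIntegral_nonneg {f : ℝ → E} {a b : ℝ} (hab : a ≤ b)
    (hf : ∀ s ∈ Set.Ioc a b, 0 ≤ f s) : 0 ≤ ∫ s in a..b, f s := by
  rw [intervalIntegral.integral_of_le hab]
  exact integral_nonneg_of_ae ((ae_restrict_iff' measurableSet_Ioc).2 (ae_of_all _ hf))

/-- Beyond any exponential growth rate, the resolvent of a positive semigroup is positive. -/
theorem IsRealResolvent.nonneg_of_growth_lt [CompleteSpace E] {T : C0Semigroup E}
    (hpos : T.IsPositive) {ω M : ℝ} (hT : ∀ t : ℝ≥0, ‖T.op t‖ ≤ M * Real.exp (ω * t)) {r : ℝ}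
    (hr : ω < r) {R : E →L[ℝ] E} (hR : T.IsRealResolvent r R) {x : E} (hx : 0 ≤ x) : 0 ≤ R x := by
  set S := T.rescale r with hS
  have h1 : Tendsto (fun n : ℕ => S.op n x) atTop (𝓝 0) := by
    have h2 : Tendsto (fun n : ℕ => (M * ‖x‖) * Real.exp (-(r - ω)) ^ n) atTop (𝓝 0) := by
      have := (tendsto_pow_atTop_nhds_zero_of_lt_one (Real.exp_pos (-(r - ω))).le
        (Real.exp_lt_one_iff.2 (by linarith))).const_mul (M * ‖x‖)
      rwa [mul_zero] at this
    refine squeeze_zero_norm (fun n => ?_) h2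
    rw [hS, rescale_op, smul_apply, norm_smul, Real.norm_eq_abs, Real.abs_exp]
    refine (mul_le_mul_of_nonneg_left ((T.op n).le_of_opNorm_le (hT n) x)
      (Real.exp_pos _).le).trans_eq ?_
    rw [← Real.exp_nat_mul, NNReal.coe_natCast,
      show (n : ℝ) * -(r - ω) = -(r * n) + ω * n by ring, Real.exp_add]
    ring
  have h2 : Tendsto (fun n : ℕ => R (x - S.op n x)) atTop (𝓝 (R x)) := by
    have := (R.continuous.tendsto _).comp (h1.const_sub x)
    rwa [sub_zero] at this
  refine ge_of_tendsto' h2 fun n => ?_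
  rw [← hR.integral_orbit]
  exact intervalIntegral_nonneg (NNReal.coe_nonneg _) fun s _ => hpos.rescale r _ x hx

/-- Positivity of the resolvent spreads to the left: `y = Q x` satisfies `y = P x + (a - b) P y`
with `P` positive, hence `y⁻ ≤ (a - b) P y⁻`, which forces `y⁻ = 0` if `(a - b) ‖P‖ < 1`. -/
theorem IsRealResolvent.nonneg_of_nonneg {T : C0Semigroup E} {a b : ℝ} {P Q : E →L[ℝ] E}
    (hP : T.IsRealResolvent a P) (hQ : T.IsRealResolvent b Q) (hba : b ≤ a)
    (hsmall : (a - b) * ‖P‖ < 1) (hP0 : ∀ x, 0 ≤ x → 0 ≤ P x) {x : E} (hx : 0 ≤ x) :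
    0 ≤ Q x := by
  set y := Q x with hy
  have hab : 0 ≤ a - b := sub_nonneg.2 hba
  have h1 : y = P x + (a - b) • P y := hP.apply_eq hQ x
  have h2 : 0 ≤ P y⁻ := hP0 _ (negPart_nonneg y)
  have h3 : -y ≤ (a - b) • P y⁻ := by
    have h4 : 0 ≤ P (y + y⁻) := hP0 _ (by
      have := neg_le_negPart y
      rwa [← sub_nonneg, sub_neg_eq_add, add_comm] at this)
    have h5 := add_nonneg (hP0 x hx) (smul_nonneg hab h4)
    rw [map_add, smul_add, ← add_assoc, ← h1] at h5
    rwa [← sub_nonneg, sub_neg_eq_add, add_comm]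
  have h6 : y⁻ ≤ (a - b) • P y⁻ := sup_le h3 (smul_nonneg hab h2)
  have h7 : ‖y⁻‖ ≤ ((a - b) * ‖P‖) * ‖y⁻‖ := by
    refine (norm_le_norm_of_nonneg_of_le (negPart_nonneg y) h6).trans ?_
    rw [norm_smul, Real.norm_of_nonneg hab, mul_assoc]
    exact mul_le_mul_of_nonneg_left (P.le_opNorm _) hab
  have h8 : ‖y⁻‖ = 0 := by nlinarith [norm_nonneg y⁻]
  exact negPart_eq_zero.1 (norm_eq_zero.1 h8)

/-- If the real half-line `[a, ∞)` consists of resolvent points of the generator of a positive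
semigroup, then the resolvent at `a` is positive. -/
theorem exists_nonneg_isRealResolvent [CompleteSpace E] (T : C0Semigroup E) (hpos : T.IsPositive)
    {a : ℝ} (ha : ∀ b, a ≤ b → ∃ R, T.IsRealResolvent b R) :
    ∃ R, T.IsRealResolvent a R ∧ ∀ x, 0 ≤ x → 0 ≤ R x := by
  obtain ⟨ω, M, -, hM⟩ := T.exists_exponential_bound
  let s : Set ℝ := {b | a ≤ b ∧
    ∀ c, b ≤ c → ∃ R, T.IsRealResolvent c R ∧ ∀ x, 0 ≤ x → 0 ≤ R x}
  have hne : s.Nonempty := by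
    refine ⟨max a (ω + 1), le_max_left _ _, fun c hc => ?_⟩
    obtain ⟨R, hR⟩ := ha c ((le_max_left _ _).trans hc)
    exact ⟨R, hR, fun x hx => hR.nonneg_of_growth_lt hpos hM
      (by linarith [(le_max_right a (ω + 1)).trans hc]) hx⟩
  have hbdd : BddBelow s := ⟨a, fun b hb => hb.1⟩
  set m := sInf s with hm
  have ham : a ≤ m := le_csInf hne fun b hb => hb.1
  obtain ⟨Q, hQ⟩ := ha m ham
  -- At points `b ∈ [m, m + δ)` the resolvent has norm at most `4 / 3 ‖Q‖`, so positivity spreads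
  -- from such a `b` to `[m - δ, b]`, and `m` could be lowered if `m > a`.
  set δ : ℝ := (4 * (‖Q‖ + 1))⁻¹ with hδ
  have hQ0 := norm_nonneg Q
  have hδ0 : 0 < δ := by positivity
  have hδQ : δ * ‖Q‖ ≤ 1 / 4 := by
    rw [hδ, inv_mul_le_iff₀ (by positivity)]
    linarith
  obtain ⟨b, hb, hbm⟩ := exists_lt_of_csInf_lt hne (lt_add_of_pos_right m hδ0)
  have hmb : m ≤ b := csInf_le hbdd hb
  obtain ⟨P, hP, hP0⟩ := hb.2 b le_rfl
  have hPn : ‖P‖ ≤ 4 / 3 * ‖Q‖ := by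
    have h1 : P = Q + (m - b) • (Q * P) := ContinuousLinearMap.ext fun x => hQ.apply_eq hP x
    have h2 : ‖P‖ ≤ ‖Q‖ + δ * (‖Q‖ * ‖P‖) := by
      calc ‖P‖ = ‖Q + (m - b) • (Q * P)‖ := congrArg _ h1
        _ ≤ ‖Q‖ + ‖(m - b) • (Q * P)‖ := norm_add_le _ _
        _ ≤ ‖Q‖ + δ * (‖Q‖ * ‖P‖) := by
          rw [norm_smul]
          gcongr
          · rw [Real.norm_eq_abs, abs_le]
            constructor <;> linarith
          · exact norm_mul_le _ _
    nlinarith [mul_le_mul_of_nonneg_right hδQ (norm_nonneg P)]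
  have hmem : max a (m - δ) ∈ s := by
    refine ⟨le_max_left _ _, fun c hc => ?_⟩
    rcases le_total b c with hbc | hcb
    · exact hb.2 c hbc
    · obtain ⟨R, hR⟩ := ha c ((le_max_left _ _).trans hc)
      have hc' : m - δ ≤ c := (le_max_right _ _).trans hc
      refine ⟨R, hR, fun x hx => hP.nonneg_of_nonneg hR hcb ?_ hP0 hx⟩
      calc (b - c) * ‖P‖ ≤ (2 * δ) * (4 / 3 * ‖Q‖) := by
            gcongr
            linarith
        _ < 1 := by linarith
  have hma : m ≤ a := by
    rcases le_max_iff.1 (csInf_le hbdd hmem) with h | h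
    · exact h
    · linarith
  refine hmem.2 a (max_le le_rfl (by linarith))

/-- The orbits of positive vectors are bounded: an order bound `v` of the orbit on `[0, τ]` gives
`τ S(t) x = ∫₀^τ S(t - s) S(s) x ds ≤ ∫_{t - τ}^t S(s) v ds ≤ R v` for all `t ≥ τ`, where
`S(t) = exp(-r t) T(t)`. -/
theorem IsRealResolvent.exists_bound_rescale [CompleteSpace E] {T : C0Semigroup E}
    (hpos : T.IsPositive) (hruc : T.IsRuc) {r : ℝ} {R : E →L[ℝ] E} (hR : T.IsRealResolvent r R)
    (hR0 : ∀ x, 0 ≤ x → 0 ≤ R x) {x : E} (hx : 0 ≤ x) :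
    ∃ C, ∀ t, ‖(T.rescale r).op t x‖ ≤ C := by
  set S := T.rescale r with hS
  have hSpos : S.IsPositive := hpos.rescale r
  have hmono : ∀ (t : ℝ≥0) {y z : E}, y ≤ z → S.op t y ≤ S.op t z := by
    intro t y z hyz
    have := hSpos t _ (sub_nonneg.2 hyz)
    rwa [map_sub, sub_nonneg] at this
  have hc : ∀ y, Continuous (S.orbit y) := S.continuous_orbit_real
  -- By relative uniform continuity the orbit of `x` is order bounded on a short interval.
  obtain ⟨τ, hτ, v, hv, hxv⟩ : ∃ τ : ℝ≥0, 0 < τ ∧ ∃ v : E, 0 ≤ v ∧ ∀ s ≤ τ, S.op s x ≤ v := by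
    obtain ⟨u, hu, h⟩ := hruc x
    obtain ⟨τ', hτ', h'⟩ := mem_nhdsGT_iff_exists_Ioc_subset.1 (h 1 one_pos)
    refine ⟨τ', hτ', Real.exp (|r| * τ') • (x + u), smul_nonneg (Real.exp_pos _).le
      (add_nonneg hx hu), fun s hs => ?_⟩
    have h1 : T.op s x ≤ x + u := by
      rcases eq_or_lt_of_le (zero_le (a := s)) with h0 | h0
      · rw [← h0, T.op_zero]
        exact le_add_of_nonneg_right hu
      · have h2 : |T.op s x - x| ≤ (1 : ℝ) • u := h' ⟨h0, hs⟩
        rw [one_smul] at h2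
        exact sub_le_iff_le_add'.1 ((le_abs_self _).trans h2)
    have h2 : Real.exp (-(r * s)) ≤ Real.exp (|r| * τ') := by
      have hs' : (s : ℝ) ≤ τ' := hs
      rw [Real.exp_le_exp, ← neg_mul]
      exact mul_le_mul (neg_le_abs r) hs' s.coe_nonneg (abs_nonneg r)
    rw [hS, rescale_op]
    exact (smul_le_smul_of_nonneg_left h1 (Real.exp_pos _).le).trans
      (smul_le_smul_of_nonneg_right h2 (add_nonneg hx hu))
  have hτ0 : (0 : ℝ) < τ := hτ
  have hkey : ∀ t, τ ≤ t → (τ : ℝ) • S.op t x ≤ R v := by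
    intro t ht
    have ht' : (τ : ℝ) ≤ t := ht
    have h1 : ∫ _ in (0 : ℝ)..τ, S.op t x = (τ : ℝ) • S.op t x := by simp
    have h2 : (τ : ℝ) • S.op t x ≤ ∫ s in (0 : ℝ)..τ, S.orbit v (t - s) := by
      have hi : IntervalIntegrable (fun s => S.orbit v (t - s)) volume 0 τ :=
        ((hc v).comp (continuous_sub_left (t : ℝ))).intervalIntegrable _ _
      rw [← h1, ← sub_nonneg, ← intervalIntegral.integral_sub hi intervalIntegrable_const]
      refine intervalIntegral_nonneg τ.coe_nonneg fun s hs => sub_nonneg.2 ?_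
      have hs0 : s.toNNReal ≤ τ := Real.toNNReal_le_iff_le_coe.2 hs.2
      have h3 : t = (t - s : ℝ).toNNReal + s.toNNReal := by
        rw [← Real.toNNReal_add (by linarith [hs.2]) hs.1.le, sub_add_cancel, Real.toNNReal_coe]
      calc S.op t x = S.op (t - s : ℝ).toNNReal (S.op s.toNNReal x) := by rw [op_op, ← h3]
        _ ≤ S.op (t - s : ℝ).toNNReal v := hmono _ (hxv _ hs0)
    rw [intervalIntegral.integral_comp_sub_left, sub_zero] at h2
    have h4 : ∫ s in (t - τ : ℝ)..t, S.orbit v s ≤ ∫ s in (0 : ℝ)..t, S.orbit v s := by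
      rw [← intervalIntegral.integral_add_adjacent_intervals
        ((hc v).intervalIntegrable 0 (t - τ : ℝ)) ((hc v).intervalIntegrable _ _)]
      exact le_add_of_nonneg_left
        (intervalIntegral_nonneg (sub_nonneg.2 ht') fun s _ => hSpos _ v hv)
    have h5 : ∫ s in (0 : ℝ)..t, S.orbit v s ≤ R v := by
      rw [hS, hR.integral_orbit, map_sub]
      exact sub_le_self _ (hR0 _ (hSpos t v hv))
    exact h2.trans (h4.trans h5)
  refine ⟨max ‖v‖ ((τ : ℝ)⁻¹ * ‖R v‖), fun t => ?_⟩
  rcases le_total t τ with ht | ht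
  · exact (norm_le_norm_of_nonneg_of_le (hSpos t x hx) (hxv t ht)).trans (le_max_left _ _)
  · refine le_trans ?_ (le_max_right _ _)
    have h1 := norm_le_norm_of_nonneg_of_le (smul_nonneg hτ0.le (hSpos t x hx)) (hkey t ht)
    rw [norm_smul, Real.norm_of_nonneg hτ0.le] at h1
    rwa [le_inv_mul_iff₀ hτ0]

/-- Only the real half-line to the right of the spectral bound enters this inequality, not the
complex half-plane. -/
theorem growthBound_le_spectralBound [CompleteSpace E] (T : C0Semigroup E) (hpos : T.IsPositive)
    (hruc : T.IsRuc) : T.growthBound ≤ spectralBound T.generator := by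
  refine EReal.le_of_forall_lt_iff_le.1 fun r hr => ?_
  obtain ⟨R, hR, hR0⟩ := T.exists_nonneg_isRealResolvent hpos fun b (hb : r ≤ b) => by
    refine T.exists_isRealResolvent (by_contra fun h => ?_)
    have h1 : ((b : ℝ) : EReal) ≤ spectralBound T.generator :=
      le_sSup ⟨(b : ℂ), h, by simp⟩
    exact absurd (hr.trans_le (EReal.coe_le_coe_iff.2 hb)) (not_lt.2 h1)
  obtain ⟨C, hC⟩ := banach_steinhaus (g := (T.rescale r).op) fun x => by
    obtain ⟨C₁, h₁⟩ := hR.exists_bound_rescale hpos hruc hR0 (posPart_nonneg x)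
    obtain ⟨C₂, h₂⟩ := hR.exists_bound_rescale hpos hruc hR0 (negPart_nonneg x)
    refine ⟨C₁ + C₂, fun t => ?_⟩
    rw [← posPart_sub_negPart x, map_sub]
    exact (norm_sub_le _ _).trans (add_le_add (h₁ t) (h₂ t))
  refine sInf_le ⟨r, ⟨max C 1, le_max_right _ _, fun t => ?_⟩, rfl⟩
  have h1 : T.op t = Real.exp (r * t) • (T.rescale r).op t := by
    rw [rescale_op, smul_smul, ← Real.exp_add, add_neg_cancel, Real.exp_zero, one_smul]
  rw [h1, norm_smul, Real.norm_eq_abs, Real.abs_exp, mul_comm]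
  exact mul_le_mul_of_nonneg_right ((hC t).trans (le_max_left _ _)) (Real.exp_pos _).le

end Positive

end C0Semigroup

end RucSemigroup

theorem mainTheorem2 {E : Type*} [NormedAddCommGroup E] [NormedSpace ℝ E] [Lattice E]
    [IsOrderedAddMonoid E] [IsOrderedModule ℝ E] [HasSolidNorm E] [CompleteSpace E]
    (T : RucSemigroup.C0Semigroup E) (hpos : T.IsPositive) (hruc : T.IsRuc) :
    RucSemigroup.spectralBound T.generator = T.growthBound :=
  le_antisymm T.spectralBound_le_growthBound (T.growthBound_le_spectralBound hpos hruc)
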